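/- **Theorem (Tonelli Theorem).** Let $I=(0,1)$ and let $L^2(I)$ be the real Hilbert space of square-integrable functions on $I$ with respect to Lebesgue measure. Let $\mathcal W:L^2(I)\to\mathbb R$ be continuous and weakly upper semicontinuous, the latter meaning that $\limsup_k\mathcal W(M_k)\le\mathcal W(M_\infty)$ whenever $M_k\rightharpoonup M_\infty$ weakly in $L^2(I)$. Suppose moreover that at least one of the following holds: * (a) $\mathcal W$ is periodic, i.e. $\mathcal W(M+N)=\mathcal W(M)$ for all $M,N\in L^2(I)$ such that $N$ takes integer values almost everywhere, and rearrangement invariant, i.e. $\mathcal W(M\circ G)=\mathcal W(M)$ for all $M\in L^2(I)$ and all Borel bijections $G:[0,1]\to[0,1]$ with Borel inverse that push Lebesgue measure on $[0,1]$ forward to itself; * (b) $\mathcal W$ is bounded, i.e. there is a constant $K_0$ with $|\mathcal W(M)|\le K_0$ for all $M\in L^2(I)$. Let $T>0$. Denote by $AC^2(0,T;L^2(I))$ the set of curves $\sigma:[0,T]\to L^2(I)$ for which there is $\beta\in L^2[0,T]$ with $\|\sigma(t)-\sigma(s)\|\le\int_s^t\beta(u)\,du$ for all $0\le s<t\le T$.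 Then every $\sigma\in AC^2(0,T;L^2(I))$ is differentiable in the norm of $L^2(I)$ at almost every $t\in[0,T]$, and $t\mapsto\frac12\|\dot\sigma(t)\|^2-\mathcal W(\sigma(t))$ is Lebesgue integrable on $[0,T]$, so that the action $$\mathbb L(\sigma)=\int_0^T\Big(\tfrac12\|\dot\sigma(t)\|_{L^2(I)}^2-\mathcal W(\sigma(t))\Big)\,dt$$ is a well-defined real number. Moreover, for all $M,N\in L^2(I)$, the action $\mathbb L$ attains its minimum over the set of all $\sigma\in AC^2(0,T;L^2(I))$ with $\sigma(0)=M$ and $\sigma(T)=N$; in particular this set is non-empty. -/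

import Mathlib

open MeasureTheory Set Filter Topology

noncomputable section

namespace TonelliL2

/-- The open unit interval `I = (0,1)`. -/
abbrev I : Set ℝ := Ioo (0 : ℝ) 1

/-- The real Hilbert space `L²(I)` with respect to Lebesgue measure. -/
abbrev L2I : Type := Lp ℝ 2 ((volume : Measure ℝ).restrict I)

/-- The group `L²_ℤ(I)` of those elements of `L²(I)` that take integer values (almost everywhere,
since elements of `L²(I)` are almost-everywhere classes). -/
def L2Z : Set L2I :=
  {N | ∀ᵐ x ∂((volume : Measure ℝ).restrict I), ∃ k : ℤ, N x = k}

/-- `W` is periodic: it is invariant under translation by elements of `L²_ℤ(I)`. -/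
def IsPeriodic (W : L2I → ℝ) : Prop :=
  ∀ M : L2I, ∀ N ∈ L2Z, W (M + N) = W M

/-- `W` is rearrangement invariant: `W (M ∘ G) = W M` for all `M ∈ L²(I)` and all Borel bijections
`G : [0,1] → [0,1]` with Borel inverse that push Lebesgue measure forward to itself.
Here `M'` is the class in `L²(I)` of `M ∘ G`. -/
def IsRearrangementInvariant (W : L2I → ℝ) : Prop :=
  ∀ G : Icc (0 : ℝ) 1 ≃ᵐ Icc (0 : ℝ) 1, MeasurePreserving G volume volume →
    ∀ M M' : L2I, (∀ᵐ x : Icc (0 : ℝ) 1, M' (x : ℝ) = M (G x : ℝ)) → W M' = W M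

/-- `W` is weakly upper semicontinuous: if `M k ⇀ M∞` weakly in `L²(I)`, then
`limsup W (M k) ≤ W M∞`. The inequality is written out so that no real-valued `limsup`
of a possibly unbounded sequence occurs. -/
def IsWeaklyUSC (W : L2I → ℝ) : Prop :=
  ∀ (M : ℕ → L2I) (Minf : L2I),
    Tendsto (fun k => toWeakSpace ℝ L2I (M k)) atTop (𝓝 (toWeakSpace ℝ L2I Minf)) →
    ∀ c : ℝ, W Minf < c → ∀ᶠ k in atTop, W (M k) < c

/-- The set `AC²(0,T;S)` of 2-absolutely continuous curves in a metric space `S`: there is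
`β ∈ L²[0,T]` with `dist (σ t) (σ s) ≤ ∫ u in s..t, β u` whenever `0 ≤ s < t ≤ T`. A curve
`[0,T] → S` is represented by a function on `ℝ` whose values outside `[0,T]` play no role. -/
def AC2 (T : ℝ) (S : Type*) [MetricSpace S] : Set (ℝ → S) :=
  {σ | ∃ β : ℝ → ℝ, MemLp β 2 ((volume : Measure ℝ).restrict (Icc 0 T)) ∧
    ∀ s t : ℝ, 0 ≤ s → s < t → t ≤ T → dist (σ t) (σ s) ≤ ∫ u in s..t, β u}

/-- The curves in `AC²(0,T;L²(I))` that go from `M` at time `0` to `N` at time `T`. -/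
def AC2From (T : ℝ) (M N : L2I) : Set (ℝ → L2I) :=
  {σ | σ ∈ AC2 T L2I ∧ σ 0 = M ∧ σ T = N}

/-- The Lagrangian `L(M,N) = ½‖N‖² - W(M)` on `L²(I) × L²(I)`. -/
def lagrangian (W : L2I → ℝ) (M N : L2I) : ℝ := (1 / 2) * ‖N‖ ^ 2 - W M

/-- The action `∫₀ᵀ L(σ(t), σ'(t)) dt`, where `σ'` is the norm derivative of `σ` in `L²(I)`. -/
def action (W : L2I → ℝ) (T : ℝ) (σ : ℝ → L2I) : ℝ :=
  ∫ t in (0 : ℝ)..T, lagrangian W (σ t) (deriv σ t)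

end TonelliL2

end

namespace TonelliL2

/-! The proof is the direct method, run on velocities. A curve in `AC2` is its initial point plus
the primitive of some `v` in the Hilbert space `L²(0,T;L²(I))` (`exists_velocity_of_mem_AC2`). This
gives differentiability almost everywhere and turns the action into `½‖v‖² - ∫ W(σ)`. `W` is bounded
above: by assumption in case (b), by weak compactness of the unit ball modulo integer-valued
functions in the periodic case. Hence a minimizing sequence has bounded velocities, and a
subsequence converges weakly. Its primitives converge weakly at each time, so endpoints survive; the
norm is weakly lower semicontinuous, and Fatou's lemma applied to `C - W ≥ 0` handles the potential.
-/

instance fact_two_ne_top : Fact ((2 : ENNReal) ≠ ⊤) := ⟨by norm_num⟩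

/-! ### Weak convergence in Hilbert spaces. -/

section Hilbert

variable {H : Type*} [NormedAddCommGroup H] [InnerProductSpace ℝ H] [CompleteSpace H]

/-- Bounded sequences in a separable Hilbert space have weakly convergent subsequences. -/
theorem exists_subseq_tendsto_inner [TopologicalSpace.SeparableSpace H] (u : ℕ → H) (R : ℝ)
    (hu : ∀ n, ‖u n‖ ≤ R) :
    ∃ (x : H) (φ : ℕ → ℕ), StrictMono φ ∧
      ∀ e, Tendsto (fun n => inner ℝ e (u (φ n))) atTop (𝓝 (inner ℝ e x)) := by
  have hc := WeakDual.isSeqCompact_closedBall ℝ H (0 : StrongDual ℝ H) R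
  obtain ⟨y, -, φ, hφ, hy⟩ := hc
    (x := fun n => StrongDual.toWeakDual (InnerProductSpace.toDual ℝ H (u n)))
    (fun n => by
      have : ‖InnerProductSpace.toDual ℝ H (u n)‖ ≤ R := by
        rw [LinearIsometryEquiv.norm_map]; exact hu n
      simpa using this)
  refine ⟨(InnerProductSpace.toDual ℝ H).symm (WeakDual.toStrongDual y), φ, hφ, fun e => ?_⟩
  have h := (tendsto_iff_forall_eval_tendsto_topDualPairing.1 hy) e
  have h1 : (topDualPairing ℝ H y) e =
      inner ℝ e ((InnerProductSpace.toDual ℝ H).symm (WeakDual.toStrongDual y)) := by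
    rw [real_inner_comm, InnerProductSpace.toDual_symm_apply]; rfl
  rw [← h1]
  refine h.congr fun n => ?_
  rw [real_inner_comm]
  rfl

/-- Convergence of all inner products is convergence in the weak topology. -/
theorem tendsto_toWeakSpace_of_tendsto_inner {u : ℕ → H} {x : H}
    (h : ∀ e, Tendsto (fun n => inner ℝ e (u n)) atTop (𝓝 (inner ℝ e x))) :
    Tendsto (fun n => toWeakSpace ℝ H (u n)) atTop (𝓝 (toWeakSpace ℝ H x)) := by
  have hB : Function.Injective (topDualPairing ℝ H).flip := by
    intro a b hab
    refine ext_inner_left ℝ fun e => ?_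
    exact congrArg (fun L => L (InnerProductSpace.toDual ℝ H e)) hab
  refine (WeakBilin.tendsto_iff_forall_eval_tendsto _ hB).2 fun y => ?_
  have h1 : ∀ z : H, inner ℝ ((InnerProductSpace.toDual ℝ H).symm y) z = y z := fun z =>
    InnerProductSpace.toDual_symm_apply
  have h2 := h ((InnerProductSpace.toDual ℝ H).symm y)
  simp only [h1] at h2
  exact h2

omit [CompleteSpace H] in
/-- The norm is weakly lower semicontinuous. -/
theorem norm_le_of_tendsto_inner {u : ℕ → H} {x : H} {r : ℝ}
    (h : ∀ e, Tendsto (fun n => inner ℝ e (u n)) atTop (𝓝 (inner ℝ e x)))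
    (hr : Tendsto (fun n => ‖u n‖) atTop (𝓝 r)) : ‖x‖ ≤ r := by
  have h0 : 0 ≤ r := ge_of_tendsto' hr fun n => norm_nonneg _
  have h1 : inner ℝ x x ≤ ‖x‖ * r :=
    le_of_tendsto_of_tendsto' (h x) (hr.const_mul _) fun n => real_inner_le_norm _ _
  rw [real_inner_self_eq_norm_sq] at h1
  rcases (norm_nonneg x).eq_or_lt with h2 | h2
  · rw [← h2]; exact h0
  · nlinarith

/-! ### Square-integrable velocities and their primitives. -/

/-- Square-integrable velocities on `(0,T]`. -/
abbrev Velocity (T : ℝ) (H : Type*) [NormedAddCommGroup H] : Type _ :=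
  Lp H 2 ((volume : Measure ℝ).restrict (Ioc 0 T))

omit [InnerProductSpace ℝ H] [CompleteSpace H] in
theorem Velocity.intervalIntegrable {T : ℝ} (hT : 0 ≤ T) (v : Velocity T H) :
    IntervalIntegrable v volume 0 T := by
  rw [intervalIntegrable_iff_integrableOn_Ioc_of_le hT]
  exact (Lp.memLp v).integrable (by norm_num)

omit [InnerProductSpace ℝ H] [CompleteSpace H] in
theorem Velocity.intervalIntegrable_sub {T : ℝ} (v : Velocity T H) {s t : ℝ}
    (hs : s ∈ Icc 0 T) (ht : t ∈ Icc 0 T) :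
    IntervalIntegrable v volume s t :=
  (v.intervalIntegrable (hs.1.trans hs.2)).mono_set
    (uIcc_subset_uIcc (by rwa [uIcc_of_le (hs.1.trans hs.2)])
      (by rwa [uIcc_of_le (hs.1.trans hs.2)]))

/-- Pairing the primitive at time `t` with `e` is testing `v` against `e` times the indicator of
`(0,t]`, hence a weakly continuous functional of `v`. -/
theorem Velocity.inner_integral {T t : ℝ} (ht : t ∈ Icc 0 T) (e : H) (v : Velocity T H) :
    inner ℝ e (∫ s in 0..t, v s) =
      inner ℝ (indicatorConstLp 2 (μ := (volume : Measure ℝ).restrict (Ioc 0 T))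
        (measurableSet_Ioc (a := (0 : ℝ)) (b := t)) (measure_ne_top _ _) e) v := by
  rw [L2.inner_indicatorConstLp_eq_inner_setIntegral ℝ, intervalIntegral.integral_of_le ht.1,
    Measure.restrict_restrict measurableSet_Ioc,
    inter_eq_left.2 (Ioc_subset_Ioc_right ht.2)]

/-- Weak convergence of velocities gives pointwise weak convergence of primitives. -/
theorem Velocity.tendsto_inner_integral {T t : ℝ} (ht : t ∈ Icc 0 T) {u : ℕ → Velocity T H}
    {v : Velocity T H}
    (h : ∀ e, Tendsto (fun n => inner ℝ e (u n)) atTop (𝓝 (inner ℝ e v))) (e : H) :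
    Tendsto (fun n => inner ℝ e (∫ s in 0..t, u n s)) atTop
      (𝓝 (inner ℝ e (∫ s in 0..t, v s))) := by
  simp only [Velocity.inner_integral ht]
  exact h _

omit [CompleteSpace H] in
theorem Velocity.norm_sq {T : ℝ} (hT : 0 ≤ T) (v : Velocity T H) :
    ‖v‖ ^ 2 = ∫ t in 0..T, ‖v t‖ ^ 2 := by
  rw [intervalIntegral.integral_of_le hT, ← real_inner_self_eq_norm_sq, L2.inner_def]
  simp

omit [InnerProductSpace ℝ H] [CompleteSpace H] in
theorem Velocity.intervalIntegrable_norm_sq {T : ℝ} (hT : 0 ≤ T) (v : Velocity T H) :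
    IntervalIntegrable (fun t => ‖v t‖ ^ 2) volume 0 T := by
  rw [intervalIntegrable_iff_integrableOn_Ioc_of_le hT]
  exact (memLp_two_iff_integrable_sq_norm (Lp.memLp v).1).1 (Lp.memLp v)

omit [CompleteSpace H] in
theorem Velocity.primitive_mem_AC2 {T : ℝ} (M : H) (v : Velocity T H) :
    (fun t => M + ∫ s in 0..t, v s) ∈ AC2 T H := by
  refine ⟨fun t => ‖v t‖, ?_, fun s t hs hst ht => ?_⟩
  · rw [← restrict_Ioc_eq_restrict_Icc]
    exact (Lp.memLp v).norm
  · have h0 : (0 : ℝ) ∈ Icc 0 T := ⟨le_rfl, hs.trans (hst.le.trans ht)⟩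
    have hsm : s ∈ Icc 0 T := ⟨hs, hst.le.trans ht⟩
    have htm : t ∈ Icc 0 T := ⟨hs.trans hst.le, ht⟩
    rw [dist_add_left, dist_eq_norm, intervalIntegral.integral_interval_sub_left
      (v.intervalIntegrable_sub h0 htm) (v.intervalIntegrable_sub h0 hsm)]
    exact intervalIntegral.norm_integral_le_integral_norm hst.le

theorem Velocity.ae_hasDerivAt {T : ℝ} (hT : 0 ≤ T) {σ : ℝ → H} (v : Velocity T H)
    (h : ∀ t ∈ Icc 0 T, σ t = σ 0 + ∫ s in 0..t, v s) :
    ∀ᵐ t ∂((volume : Measure ℝ).restrict (Ioc 0 T)), HasDerivAt σ (v t) t := by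
  rw [ae_restrict_iff' measurableSet_Ioc]
  filter_upwards [(v.intervalIntegrable hT).ae_hasDerivAt_integral, Measure.ae_ne volume T]
    with t ht htT htm
  -- The endpoint `T` is discarded because the derivative is two-sided and `σ` is arbitrary beyond
  -- `T`.
  replace htm : t ∈ Ioo 0 T := ⟨htm.1, lt_of_le_of_ne htm.2 htT⟩
  have h1 := (ht (by rw [uIcc_of_le hT]; exact Ioo_subset_Icc_self htm) 0 left_mem_uIcc).const_add
    (σ 0)
  refine h1.congr_of_eventuallyEq ?_
  filter_upwards [Ioo_mem_nhds htm.1 htm.2] with s hs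
  exact h s (Ioo_subset_Icc_self hs)

end Hilbert

/-! ### Absolutely continuous curves as primitives. -/

theorem integral_translate_sub {E : Type*} [NormedAddCommGroup E] [NormedSpace ℝ E]
    [CompleteSpace E] {f : ℝ → E} (hf : Continuous f) (h t : ℝ) :
    ∫ s in 0..t, (f (s + h) - f s) = (∫ s in t..(t + h), f s) - ∫ s in 0..h, f s := by
  have hi : ∀ a b, IntervalIntegrable f volume a b := fun a b => hf.intervalIntegrable a b
  rw [intervalIntegral.integral_sub ((by fun_prop : Continuous fun s => f (s + h)).intervalIntegrable
    _ _) (hi _ _), intervalIntegral.integral_comp_add_right, zero_add,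
    ← intervalIntegral.integral_add_adjacent_intervals (hi h t) (hi t (t + h)),
    ← intervalIntegral.integral_add_adjacent_intervals (hi 0 h) (hi h t)]
  abel

/-- Cauchy–Schwarz inequality on an interval. -/
theorem sq_intervalIntegral_le {β : ℝ → ℝ} {s t : ℝ} (hst : s ≤ t)
    (h1 : IntervalIntegrable β volume s t)
    (h2 : IntervalIntegrable (fun u => β u ^ 2) volume s t) :
    (∫ u in s..t, β u) ^ 2 ≤ (t - s) * ∫ u in s..t, β u ^ 2 := by
  rcases hst.eq_or_lt with rfl | hlt
  · simp
  set a := ∫ u in s..t, β u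
  have hc : ∀ c : ℝ, 2 * c * a ≤ (∫ u in s..t, β u ^ 2) + (t - s) * c ^ 2 := by
    intro c
    have h3 : (∫ u in s..t, 2 * c * β u) ≤ ∫ u in s..t, (β u ^ 2 + c ^ 2) :=
      intervalIntegral.integral_mono_on hst (h1.const_mul _) (h2.add intervalIntegrable_const)
        fun u _ => by nlinarith [sq_nonneg (β u - c)]
    rwa [intervalIntegral.integral_const_mul, intervalIntegral.integral_add h2
      intervalIntegrable_const, intervalIntegral.integral_const, smul_eq_mul] at h3
  have hp : 0 < t - s := sub_pos.2 hlt
  -- The mean of `β` is the optimal `c`.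
  have h4 := mul_le_mul_of_nonneg_left (hc (a / (t - s))) hp.le
  have h5 : (t - s) * (2 * (a / (t - s)) * a) = 2 * a ^ 2 := by field_simp
  have h6 : (t - s) * ((t - s) * (a / (t - s)) ^ 2) = a ^ 2 := by field_simp
  rw [mul_add, h5, h6] at h4
  linarith

variable {H : Type*} [NormedAddCommGroup H] [InnerProductSpace ℝ H] [CompleteSpace H]

omit [InnerProductSpace ℝ H] [CompleteSpace H] in
/-- A curve whose squared increments are dominated by `(t - s) * (F t - F s)` is continuous. -/
theorem continuous_of_sq_norm_sub_le {σ : ℝ → H} {F : ℝ → ℝ} (hF : Continuous F)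
    (h : ∀ s t, s ≤ t → ‖σ t - σ s‖ ^ 2 ≤ (t - s) * (F t - F s)) : Continuous σ := by
  refine continuous_iff_continuousAt.2 fun s => ?_
  have h1 : ∀ t, ‖σ t - σ s‖ ≤ √((t - s) * (F t - F s)) := fun t => by
    refine Real.le_sqrt_of_sq_le ?_
    rcases le_total s t with hst | hst
    · exact h s t hst
    · rw [norm_sub_rev]; linarith [h t s hst]
  have h2 : Tendsto (fun t => √((t - s) * (F t - F s))) (𝓝 s) (𝓝 0) := by
    have : Continuous fun t => √((t - s) * (F t - F s)) := by fun_prop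
    simpa using this.tendsto s
  exact tendsto_iff_norm_sub_tendsto_zero.2 (squeeze_zero (fun t => norm_nonneg _) h1 h2)

/-- Curves with finite energy are primitives of square-integrable velocities. -/
theorem exists_velocity_of_sq_norm_sub_le [SecondCountableTopology H] {T K : ℝ} (hT : 0 ≤ T)
    {σ : ℝ → H} {F : ℝ → ℝ} (hF : Continuous F) (hF0 : ∀ t, 0 ≤ F t) (hFK : ∀ t, F t ≤ K)
    (h : ∀ s t, s ≤ t → ‖σ t - σ s‖ ^ 2 ≤ (t - s) * (F t - F s)) :
    ∃ v : Velocity T H, ∀ t ∈ Icc 0 T, σ t = σ 0 + ∫ s in 0..t, v s := by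
  have hσ := continuous_of_sq_norm_sub_le hF h
  let d : ℕ → ℝ := fun n => 1 / ((n : ℝ) + 1)
  have hd : ∀ n, 0 < d n := fun n => by positivity
  have hd0 : Tendsto d atTop (𝓝 0) := tendsto_one_div_add_atTop_nhds_zero_nat
  -- The velocity will be a weak limit of difference quotients. Their squared norms are at most `K`,
  -- since integrating the increments of `F` leaves only boundary layers of length `d n`.
  let g : ℕ → ℝ → H := fun n t => (d n)⁻¹ • (σ (t + d n) - σ t)
  have hg : ∀ n, Continuous (g n) := fun n => by fun_prop
  have hgL : ∀ n, MemLp (g n) 2 ((volume : Measure ℝ).restrict (Ioc 0 T)) := fun n => by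
    refine (memLp_two_iff_integrable_sq_norm (hg n).aestronglyMeasurable).2 ?_
    exact (((hg n).norm.pow 2).integrableOn_Icc (a := 0) (b := T)).mono_set Ioc_subset_Icc_self
  let u : ℕ → Velocity T H := fun n => (hgL n).toLp
  have hug : ∀ n, (u n) =ᵐ[(volume : Measure ℝ).restrict (Ioc 0 T)] g n := fun n =>
    (hgL n).coeFn_toLp
  have hbound : ∀ n, ‖u n‖ ≤ √K := fun n => by
    refine Real.le_sqrt_of_sq_le ?_
    rw [Velocity.norm_sq hT]
    have e1 : ∫ t in 0..T, ‖u n t‖ ^ 2 = ∫ t in 0..T, ‖g n t‖ ^ 2 := by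
      rw [intervalIntegral.integral_of_le hT, intervalIntegral.integral_of_le hT]
      exact integral_congr_ae ((hug n).mono fun t ht => by simp only [ht])
    have e2 : ∫ t in 0..T, ‖g n t‖ ^ 2 ≤ ∫ t in 0..T, (d n)⁻¹ * (F (t + d n) - F t) := by
      refine intervalIntegral.integral_mono_on hT
        (((hg n).norm.pow 2).intervalIntegrable _ _)
        ((by fun_prop : Continuous fun t => (d n)⁻¹ * (F (t + d n) - F t)).intervalIntegrable _ _)
        fun t _ => ?_
      have := h t (t + d n) (by linarith [hd n])
      rw [add_sub_cancel_left] at this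
      simp only [g, norm_smul, mul_pow, norm_inv, Real.norm_eq_abs, abs_of_pos (hd n)]
      calc (d n)⁻¹ ^ 2 * ‖σ (t + d n) - σ t‖ ^ 2
          ≤ (d n)⁻¹ ^ 2 * (d n * (F (t + d n) - F t)) := by gcongr
        _ = (d n)⁻¹ * (F (t + d n) - F t) := by field_simp [(hd n).ne']
    rw [e1]
    refine e2.trans ?_
    rw [intervalIntegral.integral_const_mul, integral_translate_sub hF]
    have e3 : ∫ s in T..(T + d n), F s ≤ ∫ s in T..(T + d n), K :=
      intervalIntegral.integral_mono_on (by linarith [hd n]) (hF.intervalIntegrable _ _)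
        intervalIntegrable_const fun t _ => hFK t
    have e4 : 0 ≤ ∫ s in 0..(d n), F s :=
      intervalIntegral.integral_nonneg (hd n).le fun t _ => hF0 t
    rw [intervalIntegral.integral_const, smul_eq_mul, add_sub_cancel_left] at e3
    rw [inv_mul_le_iff₀ (hd n)]
    linarith
  obtain ⟨v, φ, hφ, hv⟩ := exists_subseq_tendsto_inner u (√K) hbound
  refine ⟨v, fun t ht => ?_⟩
  -- The primitive of a difference quotient is a difference of averages of `σ` near `t` and near
  -- `0`, which converge by continuity.
  have hslope : ∀ x, Tendsto (fun n => (d n)⁻¹ • ∫ s in x..(x + d n), σ s) atTop (𝓝 (σ x)) := by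
    intro x
    have h1 := (intervalIntegral.integral_hasDerivAt_right (hσ.intervalIntegrable x x)
      (hσ.stronglyMeasurableAtFilter _ _) hσ.continuousAt).tendsto_slope_zero
    have h2 : Tendsto d atTop (𝓝[≠] 0) :=
      tendsto_nhdsWithin_iff.2 ⟨hd0, Eventually.of_forall fun n => (hd n).ne'⟩
    simpa [Function.comp_def] using h1.comp h2
  have hint : ∀ n, ∫ s in 0..t, u n s =
      (d n)⁻¹ • (∫ s in t..(t + d n), σ s) - (d n)⁻¹ • ∫ s in 0..(0 + d n), σ s := fun n => by
    have e1 : ∫ s in 0..t, u n s = ∫ s in 0..t, g n s := by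
      rw [intervalIntegral.integral_of_le ht.1, intervalIntegral.integral_of_le ht.1]
      exact integral_congr_ae (ae_restrict_of_ae_restrict_of_subset
        (Ioc_subset_Ioc_right ht.2) (hug n))
    rw [e1, intervalIntegral.integral_smul, integral_translate_sub hσ, smul_sub, zero_add]
  have hlim : Tendsto (fun n => ∫ s in 0..t, u n s) atTop (𝓝 (σ t - σ 0)) := by
    simp only [hint]
    exact (hslope t).sub (hslope 0)
  have heq : σ t - σ 0 = ∫ s in 0..t, v s := by
    refine ext_inner_left ℝ fun e => ?_
    refine tendsto_nhds_unique ?_ (Velocity.tendsto_inner_integral ht hv e)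
    exact tendsto_const_nhds.inner (hlim.comp hφ.tendsto_atTop)
  rw [← heq]; abel

/-- Absolutely continuous curves are primitives of square-integrable velocities. -/
theorem exists_velocity_of_mem_AC2 [SecondCountableTopology H] {T : ℝ} (hT : 0 ≤ T) {σ : ℝ → H}
    (hσ : σ ∈ AC2 T H) :
    ∃ v : Velocity T H, ∀ t ∈ Icc 0 T, σ t = σ 0 + ∫ s in 0..t, v s := by
  obtain ⟨β, hβ, hd⟩ := hσ
  have hβ1 : IntegrableOn β (Icc 0 T) := hβ.integrable (by norm_num)
  have hβ2 : IntegrableOn (fun u => β u ^ 2) (Icc 0 T) :=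
    (memLp_two_iff_integrable_sq hβ.1).1 hβ
  let B : ℝ → ℝ := (Icc 0 T).indicator fun u => β u ^ 2
  have hB : Integrable B := (integrable_indicator_iff measurableSet_Icc).2 hβ2
  have hB0 : ∀ u, 0 ≤ B u := fun u => indicator_nonneg (fun _ _ => sq_nonneg _) u
  -- Clamping time to `[0,T]` extends the curve to `ℝ` with the energy bound intact, as difference
  -- quotients look beyond `T`.
  let P : ℝ → ℝ := fun t => max 0 (min t T)
  have hP : ∀ t, P t ∈ Icc 0 T := fun t => ⟨le_max_left _ _, max_le hT (min_le_right _ _)⟩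
  have hPm : Monotone P := fun s t hst => max_le_max_left _ (min_le_min_right _ hst)
  have hPi : ∀ t ∈ Icc 0 T, P t = t := fun t ht => by
    simp only [P, min_eq_left ht.2, max_eq_right ht.1]
  have hPL : ∀ s t, s ≤ t → P t - P s ≤ t - s := fun s t hst => by
    simp only [P]; grind
  let G : ℝ → ℝ := fun t => ∫ u in 0..t, B u
  have hG : Continuous G := intervalIntegral.continuous_primitive (fun _ _ =>
    hB.intervalIntegrable) 0
  have hGm : ∀ s t, s ≤ t → G s ≤ G t := fun s t hst => by
    have : G t - G s = ∫ u in s..t, B u :=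
      intervalIntegral.integral_interval_sub_left hB.intervalIntegrable hB.intervalIntegrable
    have h2 : 0 ≤ ∫ u in s..t, B u := intervalIntegral.integral_nonneg hst fun u _ => hB0 u
    linarith
  have hPc : Continuous P := by fun_prop
  have key : ∀ s t, s ≤ t →
      ‖σ (P t) - σ (P s)‖ ^ 2 ≤ (t - s) * (G (P t) - G (P s)) := by
    intro s t hst
    have hPst := hPm hst
    have hG0 : 0 ≤ G (P t) - G (P s) := sub_nonneg.2 (hGm _ _ hPst)
    refine le_trans ?_ (mul_le_mul_of_nonneg_right (hPL s t hst) hG0)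
    rcases hPst.eq_or_lt with he | hlt
    · simp [he]
    have hsub : Ioc (P s) (P t) ⊆ Icc 0 T := fun u hu =>
      ⟨(hP s).1.trans hu.1.le, hu.2.trans (hP t).2⟩
    have i1 : IntervalIntegrable β volume (P s) (P t) :=
      (intervalIntegrable_iff_integrableOn_Ioc_of_le hPst).2 (hβ1.mono_set hsub)
    have i2 : IntervalIntegrable (fun u => β u ^ 2) volume (P s) (P t) :=
      (intervalIntegrable_iff_integrableOn_Ioc_of_le hPst).2 (hβ2.mono_set hsub)
    have e1 : G (P t) - G (P s) = ∫ u in (P s)..(P t), β u ^ 2 := by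
      have : G (P t) - G (P s) = ∫ u in (P s)..(P t), B u :=
        intervalIntegral.integral_interval_sub_left hB.intervalIntegrable hB.intervalIntegrable
      rw [this, intervalIntegral.integral_of_le hPst, intervalIntegral.integral_of_le hPst]
      exact setIntegral_congr_fun measurableSet_Ioc fun u hu => indicator_of_mem (hsub hu) _
    rw [e1]
    have h1 := hd (P s) (P t) (hP s).1 hlt (hP t).2
    rw [dist_eq_norm] at h1
    exact (pow_le_pow_left₀ (norm_nonneg _) h1 2).trans (sq_intervalIntegral_le hPst i1 i2)
  have hGz : G 0 = 0 := intervalIntegral.integral_same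
  obtain ⟨v, hv⟩ := exists_velocity_of_sq_norm_sub_le (σ := fun t => σ (P t))
    (F := fun t => G (P t)) (K := G T) hT (hG.comp hPc)
    (fun t => hGz ▸ hGm _ _ (hP t).1) (fun t => hGm _ _ (hP t).2) key
  refine ⟨v, fun t ht => ?_⟩
  have := hv t ht
  simpa only [hPi t ht, hPi 0 ⟨le_rfl, hT⟩] using this

/-! ### Upper bound for periodic potentials. -/

/-- A periodic weakly upper semicontinuous function is bounded above. -/
theorem IsWeaklyUSC.exists_le_of_isPeriodic {W : L2I → ℝ} (husc : IsWeaklyUSC W)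
    (hper : IsPeriodic W) : ∃ C, ∀ M, W M ≤ C := by
  by_contra! hcon
  choose u hu using fun n : ℕ => hcon n
  -- Subtracting the integer part leaves values in `[0,1)` and does not change `W`.
  have hfrac : ∀ M : L2I, ∃ M' : L2I, W M' = W M ∧ ‖M'‖ ≤ 1 := by
    intro M
    have hfl : MemLp (fun x => -((⌊M x⌋ : ℤ) : ℝ)) 2 ((volume : Measure ℝ).restrict I) := by
      have hm : AEStronglyMeasurable (fun x => -((⌊M x⌋ : ℤ) : ℝ))
          ((volume : Measure ℝ).restrict I) :=
        ((measurable_from_top (f := fun k : ℤ => (k : ℝ))).comp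
          (Lp.stronglyMeasurable M).measurable.floor).neg.aestronglyMeasurable
      refine ((Lp.memLp M).norm.add (memLp_const (1 : ℝ))).of_le hm (Eventually.of_forall ?_)
      intro x
      have h1 := Int.floor_le (M x)
      have h2 := Int.lt_floor_add_one (M x)
      simp only [Pi.add_apply, Real.norm_eq_abs, abs_neg]
      rw [abs_of_nonneg (by positivity : (0 : ℝ) ≤ |M x| + 1), abs_le]
      constructor <;> linarith [le_abs_self (M x), neg_abs_le (M x)]
    have hZ : hfl.toLp ∈ L2Z := by
      filter_upwards [hfl.coeFn_toLp] with x hx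
      exact ⟨-⌊M x⌋, by rw [hx]; push_cast; rfl⟩
    refine ⟨M + hfl.toLp, hper M _ hZ, ?_⟩
    have hb : ∀ᵐ x ∂((volume : Measure ℝ).restrict I), ‖(M + hfl.toLp : L2I) x‖ ≤ 1 := by
      filter_upwards [hfl.coeFn_toLp, Lp.coeFn_add M hfl.toLp] with x hx hx2
      rw [hx2, Pi.add_apply, hx, Real.norm_eq_abs, ← sub_eq_add_neg, Int.self_sub_floor,
        abs_of_nonneg (Int.fract_nonneg _)]
      exact (Int.fract_lt_one _).le
    refine (Lp.norm_le_of_ae_bound zero_le_one hb).trans ?_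
    simp [measureUnivNNReal]
  choose w hw hw1 using fun n => hfrac (u n)
  obtain ⟨x, φ, hφ, hx⟩ := exists_subseq_tendsto_inner w 1 hw1
  have h1 := husc (fun n => w (φ n)) x (tendsto_toWeakSpace_of_tendsto_inner hx) (W x + 1)
    (by linarith)
  obtain ⟨n, hn1, hn2⟩ := (h1.and (eventually_ge_atTop ⌈W x + 1⌉₊)).exists
  have h3 := hu (φ n)
  rw [← hw] at h3
  have h4 : W x + 1 ≤ (φ n : ℝ) :=
    (Nat.le_ceil _).trans (by exact_mod_cast hn2.trans (hφ.id_le n))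
  linarith

/-! ### The action and its minimizers. -/

variable {W : L2I → ℝ} {T : ℝ} {σ : ℝ → L2I} {v : Velocity T L2I}

theorem Velocity.continuousOn_of_eq_primitive (hT : 0 ≤ T)
    (h : ∀ t ∈ Icc 0 T, σ t = σ 0 + ∫ s in 0..t, v s) : ContinuousOn σ (Icc 0 T) := by
  have h1 := intervalIntegral.continuousOn_primitive_interval'
    (v.intervalIntegrable hT) left_mem_uIcc
  rw [uIcc_of_le hT] at h1
  exact (continuousOn_const.add h1).congr h

theorem Velocity.intervalIntegrable_potential (hcont : Continuous W) (hT : 0 ≤ T)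
    (h : ∀ t ∈ Icc 0 T, σ t = σ 0 + ∫ s in 0..t, v s) :
    IntervalIntegrable (fun t => W (σ t)) volume 0 T :=
  ContinuousOn.intervalIntegrable_of_Icc hT
    (hcont.comp_continuousOn (Velocity.continuousOn_of_eq_primitive hT h))

theorem Velocity.ae_lagrangian_eq (W : L2I → ℝ) (hT : 0 ≤ T)
    (h : ∀ t ∈ Icc 0 T, σ t = σ 0 + ∫ s in 0..t, v s) :
    ∀ᵐ t ∂((volume : Measure ℝ).restrict (Ioc 0 T)),
      lagrangian W (σ t) (deriv σ t) = 1 / 2 * ‖v t‖ ^ 2 - W (σ t) :=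
  (v.ae_hasDerivAt hT h).mono fun t ht => by rw [lagrangian, ht.deriv]

theorem Velocity.intervalIntegrable_lagrangian (hcont : Continuous W) (hT : 0 ≤ T)
    (h : ∀ t ∈ Icc 0 T, σ t = σ 0 + ∫ s in 0..t, v s) :
    IntervalIntegrable (fun t => lagrangian W (σ t) (deriv σ t)) volume 0 T := by
  refine (((v.intervalIntegrable_norm_sq hT).const_mul (1 / 2)).sub
    (Velocity.intervalIntegrable_potential hcont hT h)).congr_ae ?_
  rw [uIoc_of_le hT]
  exact (v.ae_lagrangian_eq W hT h).mono fun t ht => ht.symm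

theorem Velocity.action_eq (hcont : Continuous W) (hT : 0 ≤ T)
    (h : ∀ t ∈ Icc 0 T, σ t = σ 0 + ∫ s in 0..t, v s) :
    action W T σ = 1 / 2 * ‖v‖ ^ 2 - ∫ t in 0..T, W (σ t) := by
  rw [v.norm_sq hT, ← intervalIntegral.integral_const_mul, ← intervalIntegral.integral_sub
    ((v.intervalIntegrable_norm_sq hT).const_mul _)
    (Velocity.intervalIntegrable_potential hcont hT h), action,
    intervalIntegral.integral_of_le hT, intervalIntegral.integral_of_le hT]
  exact integral_congr_ae (v.ae_lagrangian_eq W hT h)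

/-- Fatou's lemma for functions bounded below, with pointwise lower bounds in the limit. -/
theorem integral_le_of_tendsto_of_forall_eventually_lt {α : Type*} [MeasurableSpace α]
    {μ : Measure α} {f : ℕ → α → ℝ} {g : α → ℝ} {a : ℝ}
    (hf : ∀ n, Integrable (f n) μ) (hf0 : ∀ n, 0 ≤ᵐ[μ] f n) (hg : Integrable g μ)
    (hg0 : 0 ≤ᵐ[μ] g)
    (hfg : ∀ᵐ x ∂μ, ∀ c < g x, ∀ᶠ n in atTop, c < f n x)
    (ha : Tendsto (fun n => ∫ x, f n x ∂μ) atTop (𝓝 a)) : ∫ x, g x ∂μ ≤ a := by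
  have ha0 : 0 ≤ a := ge_of_tendsto' ha fun n => integral_nonneg_of_ae (hf0 n)
  rw [← ENNReal.ofReal_le_ofReal_iff ha0, ofReal_integral_eq_lintegral_ofReal hg hg0]
  have h1 : ∫⁻ x, ENNReal.ofReal (g x) ∂μ ≤
      ∫⁻ x, liminf (fun n => ENNReal.ofReal (f n x)) atTop ∂μ := by
    refine lintegral_mono_ae ?_
    filter_upwards [hfg] with x hx
    refine le_of_forall_lt fun b hb => ?_
    obtain ⟨b', hbb', hb'⟩ := exists_between hb
    have hb't : b' ≠ ⊤ := hb'.ne_top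
    have h2 : b'.toReal < g x := (ENNReal.lt_ofReal_iff_toReal_lt hb't).1 hb'
    refine hbb'.trans_le (le_liminf_of_le (by isBoundedDefault) ?_)
    filter_upwards [hx _ h2] with n hn
    exact ((ENNReal.lt_ofReal_iff_toReal_lt hb't).2 hn).le
  refine h1.trans ((lintegral_liminf_le' fun n => (hf n).1.aemeasurable.ennreal_ofReal).trans ?_)
  have h3 : ∀ n, ∫⁻ x, ENNReal.ofReal (f n x) ∂μ = ENNReal.ofReal (∫ x, f n x ∂μ) := fun n =>
    (ofReal_integral_eq_lintegral_ofReal (hf n) (hf0 n)).symm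
  simp only [h3]
  exact ((ENNReal.tendsto_ofReal ha).liminf_eq).le

theorem AC2From_nonempty (hT : 0 < T) (M N : L2I) : (AC2From T M N).Nonempty := by
  refine ⟨fun t => M + (t / T) • (N - M), ⟨fun _ => ‖N - M‖ / T, memLp_const _, ?_⟩, ?_, ?_⟩
  · intro s t _ hst _
    rw [dist_add_left, dist_eq_norm, ← sub_smul, norm_smul, intervalIntegral.integral_const,
      smul_eq_mul, ← sub_div, Real.norm_eq_abs, abs_of_nonneg
      (div_nonneg (sub_nonneg.2 hst.le) hT.le)]
    exact le_of_eq (by ring)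
  · simp
  · simp [hT.ne']

/-- The direct method: the action of a potential bounded above has a minimizer. -/
theorem exists_isMinOn_action (hcont : Continuous W) (husc : IsWeaklyUSC W) {C : ℝ}
    (hC : ∀ M, W M ≤ C) (hT : 0 < T) (M N : L2I) :
    ∃ σ ∈ AC2From T M N, IsMinOn (action W T) (AC2From T M N) σ := by
  have hint : ∀ {σ : ℝ → L2I} {v : Velocity T L2I},
      (∀ t ∈ Icc 0 T, σ t = σ 0 + ∫ s in 0..t, v s) →
      Integrable (fun t => C - W (σ t)) ((volume : Measure ℝ).restrict (Ioc 0 T)) :=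
    fun {σ v} h => (integrable_const C).sub ((intervalIntegrable_iff_integrableOn_Ioc_of_le
      hT.le).1 (Velocity.intervalIntegrable_potential hcont hT.le h))
  have hact : ∀ {σ : ℝ → L2I} {v : Velocity T L2I},
      (∀ t ∈ Icc 0 T, σ t = σ 0 + ∫ s in 0..t, v s) →
      ∫ t in Ioc 0 T, (C - W (σ t)) = action W T σ - 1 / 2 * ‖v‖ ^ 2 + C * T := by
    intro σ v h
    rw [Velocity.action_eq hcont hT.le h, integral_sub (integrable_const _)
      ((intervalIntegrable_iff_integrableOn_Ioc_of_le hT.le).1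
        (Velocity.intervalIntegrable_potential hcont hT.le h)),
      intervalIntegral.integral_of_le hT.le, setIntegral_const]
    simp [hT.le]
    ring
  have hlow : ∀ {σ : ℝ → L2I} {v : Velocity T L2I},
      (∀ t ∈ Icc 0 T, σ t = σ 0 + ∫ s in 0..t, v s) →
      1 / 2 * ‖v‖ ^ 2 - C * T ≤ action W T σ := by
    intro σ v h
    have h1 : 0 ≤ ∫ t in Ioc 0 T, (C - W (σ t)) := integral_nonneg fun t => sub_nonneg.2 (hC _)
    rw [hact h] at h1
    linarith
  set A : Set ℝ := action W T '' AC2From T M N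
  have hAne : A.Nonempty := (AC2From_nonempty hT M N).image _
  have hAbd : BddBelow A := by
    refine ⟨-(C * T), ?_⟩
    rintro _ ⟨σ, hσ, rfl⟩
    obtain ⟨v, hv⟩ := exists_velocity_of_mem_AC2 hT.le hσ.1
    have := hlow hv
    nlinarith [sq_nonneg ‖v‖]
  obtain ⟨a, ha_anti, ha_lim, haA⟩ := exists_seq_tendsto_sInf hAne hAbd
  choose σ hσ hσa using haA
  choose v hv using fun n => exists_velocity_of_mem_AC2 hT.le (hσ n).1
  have hσa' : ∀ n, action W T (σ n) ≤ a 0 := fun n => (hσa n).le.trans (ha_anti (Nat.zero_le n))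
  have hvb : ∀ n, ‖v n‖ ≤ √(2 * (a 0 + C * T)) := fun n => by
    refine Real.le_sqrt_of_sq_le ?_
    linarith [hlow (hv n), hσa' n]
  obtain ⟨x, φ, hφ, hx⟩ := exists_subseq_tendsto_inner v _ hvb
  -- A second extraction makes the norms converge, so that kinetic and potential terms have separate
  -- limits.
  obtain ⟨r, -, ψ, hψ, hr⟩ := tendsto_subseq_of_bounded
    (Metric.isBounded_Icc (0 : ℝ) (√(2 * (a 0 + C * T))))
    (x := fun n => ‖v (φ n)‖) (fun n => ⟨norm_nonneg _, hvb _⟩)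
  have hθ : StrictMono (φ ∘ ψ) := hφ.comp hψ
  have hx' : ∀ e, Tendsto (fun n => inner ℝ e (v ((φ ∘ ψ) n))) atTop (𝓝 (inner ℝ e x)) :=
    fun e => (hx e).comp hψ.tendsto_atTop
  have hxr : ‖x‖ ≤ r := norm_le_of_tendsto_inner hx' hr
  let τ : ℝ → L2I := fun t => M + ∫ s in 0..t, x s
  have hτ0 : τ 0 = M := by simp [τ]
  have hτ : ∀ t ∈ Icc 0 T, τ t = τ 0 + ∫ s in 0..t, x s := fun t _ => by rw [hτ0]
  have hweak : ∀ t ∈ Icc 0 T, ∀ e,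
      Tendsto (fun n => inner ℝ e (σ ((φ ∘ ψ) n) t)) atTop (𝓝 (inner ℝ e (τ t))) := by
    intro t ht e
    have h1 := (Velocity.tendsto_inner_integral ht hx' e).const_add (inner ℝ e M)
    simp only [← inner_add_right] at h1
    refine h1.congr fun n => ?_
    rw [hv _ t ht, (hσ _).2.1]
  have hτT : τ T = N := by
    refine ext_inner_left ℝ fun e => ?_
    refine tendsto_nhds_unique (hweak T ⟨hT.le, le_rfl⟩ e) ?_
    simp only [(hσ _).2.2]
    exact tendsto_const_nhds
  have hτmem : τ ∈ AC2From T M N := ⟨x.primitive_mem_AC2 M, hτ0, hτT⟩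
  refine ⟨τ, hτmem, fun ρ hρ => ?_⟩
  have hle : action W T τ ≤ sInf A := by
    -- The actions tend to the infimum and the kinetic terms to `r²/2`, which fixes the limit of the
    -- potential terms; `‖x‖ ≤ r` then closes the estimate.
    have hlim : Tendsto (fun n => ∫ t in Ioc 0 T, (C - W (σ ((φ ∘ ψ) n) t))) atTop
        (𝓝 (sInf A - 1 / 2 * r ^ 2 + C * T)) := by
      simp only [fun n => hact (hv n), hσa]
      exact ((ha_lim.comp hθ.tendsto_atTop).sub ((hr.pow 2).const_mul _)).add_const _
    have h1 := integral_le_of_tendsto_of_forall_eventually_lt (fun n => hint (hv ((φ ∘ ψ) n)))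
      (fun n => Eventually.of_forall fun t => sub_nonneg.2 (hC _)) (hint hτ)
      (Eventually.of_forall fun t => sub_nonneg.2 (hC _))
      ((ae_restrict_iff' measurableSet_Ioc).2 (Eventually.of_forall fun t ht c hc => by
        filter_upwards [husc _ _ (tendsto_toWeakSpace_of_tendsto_inner
          (hweak t (Ioc_subset_Icc_self ht))) (C - c) (by linarith)] with n hn
        linarith)) hlim
    rw [hact hτ] at h1
    nlinarith [pow_le_pow_left₀ (norm_nonneg x) hxr 2]
  exact hle.trans (csInf_le hAbd ⟨ρ, hρ, rfl⟩)

end TonelliL2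

theorem theorem3p1 (W : TonelliL2.L2I → ℝ)
    (hcont : Continuous W)
    (husc : TonelliL2.IsWeaklyUSC W)
    (hW : (TonelliL2.IsPeriodic W ∧ TonelliL2.IsRearrangementInvariant W) ∨
      ∃ K₀ : ℝ, ∀ M, |W M| ≤ K₀)
    (T : ℝ) (hT : 0 < T) (M N : TonelliL2.L2I) :
    (∀ σ ∈ TonelliL2.AC2 T TonelliL2.L2I,
      (∀ᵐ t ∂((volume : Measure ℝ).restrict (Icc 0 T)), DifferentiableAt ℝ σ t) ∧
      IntervalIntegrable (fun t => TonelliL2.lagrangian W (σ t) (deriv σ t)) volume 0 T) ∧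
    ∃ σ ∈ TonelliL2.AC2From T M N,
      IsMinOn (TonelliL2.action W T) (TonelliL2.AC2From T M N) σ := by
  refine ⟨fun σ hσ => ?_, ?_⟩
  · obtain ⟨v, hv⟩ := TonelliL2.exists_velocity_of_mem_AC2 hT.le hσ
    refine ⟨?_, TonelliL2.Velocity.intervalIntegrable_lagrangian hcont hT.le hv⟩
    rw [← restrict_Ioc_eq_restrict_Icc]
    exact (v.ae_hasDerivAt hT.le hv).mono fun t ht => ht.differentiableAt
  · obtain ⟨C, hC⟩ : ∃ C, ∀ M, W M ≤ C := by
      rcases hW with ⟨hper, -⟩ | ⟨K, hK⟩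
      · exact husc.exists_le_of_isPeriodic hper
      · exact ⟨K, fun M => (le_abs_self _).trans (hK M)⟩
    exact TonelliL2.exists_isMinOn_action hcont husc hC hT M N
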